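/- All graphs are finite, simple and undirected; $K_1$ is the one-vertex graph. Write $G\to H$ if there is a graph homomorphism from $G$ to $H$. The join $G+H$ is the disjoint union of $G$ and $H$ together with all edges between $V(G)$ and $V(H)$. The disjunctive product $G\ast H$ has vertex set $V(G)\times V(H)$, with $(v,w)\sim(v',w')$ if and only if $v\sim v'$ or $w\sim w'$; $G^{\ast n}$ is the $n$-fold disjunctive product of $G$ with itself ($G^{\ast 0}=K_1$). With join as addition, disjunctive product as multiplication, and the preorder $G\le H :\Leftrightarrow G\to H$, the isomorphism classes of finite graphs form a preordered commutative semiring $\mathsf{FinGraph}$ (its zero is the graph with no vertices, its one is $K_1$). A semiring-homomorphic graph invariant is an order-preserving semiring homomorphism $\eta:\mathsf{FinGraph}\to\mathbb{R}_{\ge 0}$. Theorem. Let $G$ and $H$ be finite graphs such that $G$ has at least one edge and $H$ has at least one vertex. Then, in $[0,\infty]$, $$R(G\to H):=\sup\left\{\frac mn \;\middle|\; m,n\in\mathbb{N},\ n\ge 1,\ H^{\ast m}\to G^{\ast n}\right\}=\inf_\eta\frac{\log\eta(G)}{\log\eta(H)},$$ where $\eta$ ranges over all semiring-homomorphic graph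 invariants, and where the quotient is read as $+\infty$ if $\log\eta(H)=0$ (so that both sides are $+\infty$ if $H$ has no edge). -/

import Mathlib

open scoped ENNReal NNReal

universe u

namespace GraphRate

/-- There is a graph homomorphism `G → H`. -/
def HomExists {V W : Type*} (G : SimpleGraph V) (H : SimpleGraph W) : Prop :=
  Nonempty (G →g H)

/-- The graph join `G + H`: the disjoint union of `G` and `H` together with all edges between
a vertex of `G` and a vertex of `H`. -/
def join {V W : Type*} (G : SimpleGraph V) (H : SimpleGraph W) : SimpleGraph (V ⊕ W) where
  Adj
    | Sum.inl v, Sum.inl v' => G.Adj v v'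
    | Sum.inr w, Sum.inr w' => H.Adj w w'
    | Sum.inl _, Sum.inr _ => True
    | Sum.inr _, Sum.inl _ => True
  symm.symm := by
    rintro (v | w) (v' | w') h
    · exact G.adj_symm h
    · trivial
    · trivial
    · exact H.adj_symm h
  loopless.irrefl := by
    rintro (v | w) h
    · exact G.loopless.irrefl v h
    · exact H.loopless.irrefl w h

/-- The disjunctive product `G ∗ H`: `(v, w)` and `(v', w')` are adjacent if and only if
`v ∼ v'` or `w ∼ w'`. -/
def disjProd {V W : Type*} (G : SimpleGraph V) (H : SimpleGraph W) : SimpleGraph (V × W) where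
  Adj p q := G.Adj p.1 q.1 ∨ H.Adj p.2 q.2
  symm.symm := fun _ _ h => h.imp G.adj_symm H.adj_symm
  loopless.irrefl := fun p h => h.elim (G.loopless.irrefl p.1) (H.loopless.irrefl p.2)

/-- The `n`-fold disjunctive product of `G` with itself, on `n`-tuples of vertices: two tuples are
adjacent if and only if they are adjacent in at least one coordinate. For `n = 0` this is the
one-vertex graph. -/
def disjPow {V : Type*} (G : SimpleGraph V) (n : ℕ) : SimpleGraph (Fin n → V) where
  Adj x y := ∃ i, G.Adj (x i) (y i)
  symm.symm := fun _ _ ⟨i, h⟩ => ⟨i, G.adj_symm h⟩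
  loopless.irrefl := fun x ⟨i, h⟩ => G.loopless.irrefl (x i) h

/-- The rate `R(G → H)`, the supremum in `[0, ∞]` of the fractions `m / n` with `n ≥ 1` such that
there is a graph homomorphism from the `m`-th disjunctive power of `H` to the `n`-th disjunctive
power of `G`. -/
noncomputable def rate {V W : Type*} (G : SimpleGraph V) (H : SimpleGraph W) : ℝ≥0∞ :=
  sSup {r : ℝ≥0∞ | ∃ m n : ℕ, 0 < n ∧ HomExists (disjPow H m) (disjPow G n) ∧
    r = (m : ℝ≥0∞) / (n : ℝ≥0∞)}

/-! ### The preordered commutative semiring of finite graphs -/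

/-- A finite graph, bundled with its vertex type. -/
structure BundledFinGraph : Type (u + 1) where
  V : Type u
  [finite : Finite V]
  graph : SimpleGraph V

attribute [instance] BundledFinGraph.finite

/-- Graph isomorphism as an equivalence relation on finite graphs. -/
instance isoSetoid : Setoid BundledFinGraph.{u} where
  r G H := Nonempty (G.graph ≃g H.graph)
  iseqv :=
    { refl := fun _ => ⟨SimpleGraph.Iso.refl⟩
      symm := fun ⟨e⟩ => ⟨e.symm⟩
      trans := fun ⟨e⟩ ⟨f⟩ => ⟨e.trans f⟩ }

/-- The collection of isomorphism classes of finite graphs. -/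
def FinGraph : Type (u + 1) := Quotient isoSetoid.{u}

/-- The isomorphism class of a finite graph. -/
def FinGraph.mk {V : Type u} [Finite V] (G : SimpleGraph V) : FinGraph.{u} :=
  Quotient.mk isoSetoid ⟨V, G⟩

theorem FinGraph.mk_eq {V W : Type u} [Finite V] [Finite W] {G : SimpleGraph V}
    {H : SimpleGraph W} (e : V ≃ W) (h : ∀ v v', H.Adj (e v) (e v') ↔ G.Adj v v') :
    FinGraph.mk G = FinGraph.mk H :=
  Quotient.sound ⟨⟨e, h _ _⟩⟩

theorem FinGraph.ind {p : FinGraph.{u} → Prop}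
    (h : ∀ (V : Type u) [Finite V] (G : SimpleGraph V), p (FinGraph.mk G)) (x : FinGraph.{u}) :
    p x :=
  Quotient.ind (fun g => @h g.V g.finite g.graph) x

/-- The preorder on finite graphs: `G ≤ H` if and only if there is a homomorphism `G → H`. -/
instance : Preorder FinGraph.{u} where
  le := Quotient.lift₂ (fun G H => HomExists G.graph H.graph) (by
    rintro G H G' H' ⟨e⟩ ⟨f⟩
    exact propext ⟨fun ⟨k⟩ => ⟨f.toHom.comp (k.comp e.symm.toHom)⟩,
      fun ⟨k⟩ => ⟨f.symm.toHom.comp (k.comp e.toHom)⟩⟩)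
  le_refl x := by
    induction x using FinGraph.ind with
    | h V G => exact ⟨SimpleGraph.Hom.id⟩
  le_trans x y z := by
    induction x using FinGraph.ind with
    | h V G =>
    induction y using FinGraph.ind with
    | h W H =>
    induction z using FinGraph.ind with
    | h X K => exact fun ⟨k⟩ ⟨l⟩ => ⟨l.comp k⟩

/-- Addition is the graph join. -/
instance : Add FinGraph.{u} where
  add := Quotient.map₂ (fun G H => ⟨G.V ⊕ H.V, join G.graph H.graph⟩) (by
    rintro G G' ⟨e⟩ H H' ⟨f⟩
    refine ⟨⟨Equiv.sumCongr e.toEquiv f.toEquiv, ?_⟩⟩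
    rintro (v | w) (v' | w')
    · exact e.map_adj_iff
    · exact Iff.rfl
    · exact Iff.rfl
    · exact f.map_adj_iff)

/-- Multiplication is the disjunctive product. -/
instance : Mul FinGraph.{u} where
  mul := Quotient.map₂ (fun G H => ⟨G.V × H.V, disjProd G.graph H.graph⟩) (by
    rintro G G' ⟨e⟩ H H' ⟨f⟩
    exact ⟨⟨Equiv.prodCongr e.toEquiv f.toEquiv, or_congr e.map_adj_iff f.map_adj_iff⟩⟩)

/-- Zero is the graph without vertices. -/
instance : Zero FinGraph.{u} := ⟨FinGraph.mk (⊥ : SimpleGraph PEmpty.{u + 1})⟩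

/-- One is the graph `K₁` with a single vertex. -/
instance : One FinGraph.{u} := ⟨FinGraph.mk (⊥ : SimpleGraph PUnit.{u + 1})⟩

theorem FinGraph.mk_le_mk {V W : Type u} [Finite V] [Finite W] (G : SimpleGraph V)
    (H : SimpleGraph W) : FinGraph.mk G ≤ FinGraph.mk H ↔ HomExists G H := Iff.rfl

theorem FinGraph.mk_add_mk {V W : Type u} [Finite V] [Finite W] (G : SimpleGraph V)
    (H : SimpleGraph W) : FinGraph.mk G + FinGraph.mk H = FinGraph.mk (join G H) := rfl

theorem FinGraph.mk_mul_mk {V W : Type u} [Finite V] [Finite W] (G : SimpleGraph V)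
    (H : SimpleGraph W) : FinGraph.mk G * FinGraph.mk H = FinGraph.mk (disjProd G H) := rfl

theorem FinGraph.zero_def :
    (0 : FinGraph.{u}) = FinGraph.mk (⊥ : SimpleGraph PEmpty.{u + 1}) := rfl

theorem FinGraph.one_def :
    (1 : FinGraph.{u}) = FinGraph.mk (⊥ : SimpleGraph PUnit.{u + 1}) := rfl

theorem FinGraph.add_comm' (x y : FinGraph.{u}) : x + y = y + x := by
  induction x using FinGraph.ind with
  | h V G =>
  induction y using FinGraph.ind with
  | h W H =>
  refine FinGraph.mk_eq (Equiv.sumComm _ _) ?_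
  rintro (v | w) (v' | w') <;> exact Iff.rfl

theorem FinGraph.mul_comm' (x y : FinGraph.{u}) : x * y = y * x := by
  induction x using FinGraph.ind with
  | h V G =>
  induction y using FinGraph.ind with
  | h W H =>
  exact FinGraph.mk_eq (Equiv.prodComm _ _) fun _ _ => or_comm

theorem FinGraph.zero_add' (x : FinGraph.{u}) : 0 + x = x := by
  induction x using FinGraph.ind with
  | h V G =>
  refine FinGraph.mk_eq (Equiv.emptySum _ _) ?_
  rintro (v | w) (v' | w')
  · exact v.elim
  · exact v.elim
  · exact v'.elim
  · exact Iff.rfl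

theorem FinGraph.one_mul' (x : FinGraph.{u}) : 1 * x = x := by
  induction x using FinGraph.ind with
  | h V G =>
  exact FinGraph.mk_eq (Equiv.punitProd _) fun _ _ => ⟨Or.inr, fun h => h.resolve_left id⟩

theorem FinGraph.zero_mul' (x : FinGraph.{u}) : 0 * x = 0 := by
  induction x using FinGraph.ind with
  | h V G =>
  exact FinGraph.mk_eq (Equiv.pemptyProd _) fun v => v.1.elim

theorem FinGraph.add_assoc' (x y z : FinGraph.{u}) : x + y + z = x + (y + z) := by
  induction x using FinGraph.ind with
  | h V G =>
  induction y using FinGraph.ind with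
  | h W H =>
  induction z using FinGraph.ind with
  | h X K =>
  refine FinGraph.mk_eq (Equiv.sumAssoc _ _ _) ?_
  rintro ((v | v) | v) ((w | w) | w) <;> exact Iff.rfl

theorem FinGraph.mul_assoc' (x y z : FinGraph.{u}) : x * y * z = x * (y * z) := by
  induction x using FinGraph.ind with
  | h V G =>
  induction y using FinGraph.ind with
  | h W H =>
  induction z using FinGraph.ind with
  | h X K =>
  exact FinGraph.mk_eq (Equiv.prodAssoc _ _ _) fun _ _ => or_assoc.symm

theorem FinGraph.add_mul' (x y z : FinGraph.{u}) : (x + y) * z = x * z + y * z := by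
  induction x using FinGraph.ind with
  | h V G =>
  induction y using FinGraph.ind with
  | h W H =>
  induction z using FinGraph.ind with
  | h X K =>
  refine FinGraph.mk_eq (Equiv.sumProdDistrib _ _ _) ?_
  rintro ⟨v | v, a⟩ ⟨w | w, b⟩
  · exact Iff.rfl
  · exact ⟨fun _ => Or.inl trivial, fun _ => trivial⟩
  · exact ⟨fun _ => Or.inl trivial, fun _ => trivial⟩
  · exact Iff.rfl

/-- The commutative semiring of finite graphs. -/
instance : CommSemiring FinGraph.{u} where
  add_assoc := FinGraph.add_assoc'
  zero_add := FinGraph.zero_add'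
  add_zero x := (FinGraph.add_comm' x 0).trans (FinGraph.zero_add' x)
  add_comm := FinGraph.add_comm'
  mul_assoc := FinGraph.mul_assoc'
  one_mul := FinGraph.one_mul'
  mul_one x := (FinGraph.mul_comm' x 1).trans (FinGraph.one_mul' x)
  mul_comm := FinGraph.mul_comm'
  zero_mul := FinGraph.zero_mul'
  mul_zero x := (FinGraph.mul_comm' x 0).trans (FinGraph.zero_mul' x)
  right_distrib := FinGraph.add_mul'
  left_distrib x y z := by
    rw [FinGraph.mul_comm' x, FinGraph.add_mul', FinGraph.mul_comm' y, FinGraph.mul_comm' z]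
  nsmul := nsmulRec

/-- A semiring-homomorphic graph invariant: an order-preserving semiring homomorphism from the
preordered semiring of finite graphs to the nonnegative reals. -/
abbrev SemiringHomomorphicInvariant : Type (u + 1) := FinGraph.{u} →+*o ℝ≥0

/-- The logarithm `log η(G)` as an element of `[0, ∞]`. For a graph `G` with at least one vertex,
`η(G) ≥ 1`, so nothing is truncated. -/
noncomputable def logInv (η : SemiringHomomorphicInvariant.{u}) {V : Type u} [Finite V]
    (G : SimpleGraph V) : ℝ≥0∞ :=
  ENNReal.ofReal (Real.log (η (FinGraph.mk G) : ℝ))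

end GraphRate

namespace GraphRate

/-! The bound `rate ≤ inf` is direct: an invariant turns `H^m ≤ G^n` into `m log η(H) ≤ n log η(G)`
(`rate_le_logInv_div`).

The converse is Strassen duality for preordered semirings. A preorder compatible with `+` and `*` is
a submodule of `S × S`. By Zorn it extends to one maximal among those never relating `c + 1` to `c`,
and maximality forces transitivity and totality. Comparing multiples of `x` with natural numbers
then gives a monotone homomorphism to the nonnegative reals (`characterHom`). Hence if every such
homomorphism is strictly larger at `b` than at `a`, adjoining `b ≤ a` cannot be consistent, which
means `s * a + 1 + d ≤ s * b + d` for some `s`, `d` (`exists_mul_add_le`).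

Amplification removes `s` and `d`: taking multiples makes `d` negligible, taking powers makes `s`
negligible (`exists_pow_le`). Apply this to `a = H^p`, `b = G^q` for a fraction `p / q` below the
infimum. Since `2 ≤ G`, powers of `G` absorb the remaining constants, and the resulting fractions
tend to `p / q`. -/

/-- A Strassen preorder on a commutative semiring: every element is nonnegative, every nonzero
element lies between `1` and a natural number, and the order on natural numbers is reflected. -/
class StrassenPreorder (S : Type*) [CommSemiring S] [Preorder S] : Prop
    extends IsOrderedAddMonoid S, MulLeftMono S where
  nonneg : ∀ x : S, 0 ≤ x
  one_le_of_ne_zero : ∀ x : S, x ≠ 0 → 1 ≤ x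
  exists_le_natCast : ∀ x : S, ∃ n : ℕ, x ≤ n
  natCast_reflect : ∀ m n : ℕ, (m : S) ≤ n → m ≤ n

/-! ### Maximal proper relations -/

section Cone

variable {S : Type*} [CommSemiring S]

/-- A submodule of `S × S`, viewed as a relation, is proper if it does not relate `c + 1` to `c`
for any `c`. -/
def ProperRel (M : Submodule S (S × S)) : Prop := ∀ c : S, (c + 1, c) ∉ M

theorem ProperRel.exists_maximal {M : Submodule S (S × S)} (hM : ProperRel M) :
    ∃ N, M ≤ N ∧ Maximal ProperRel N := by
  refine zorn_le_nonempty₀ {N | ProperRel N} ?_ M hM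
  intro C hC hchain y hy
  refine ⟨sSup C, ?_, fun z hz => le_sSup hz⟩
  intro c hc
  obtain ⟨N, hN, hcN⟩ := (Submodule.mem_sSup_of_directed ⟨y, hy⟩ hchain.directedOn).1 hc
  exact hC hN c hcN

/-- By maximality, adjoining `p` destroys properness; the result is an explicit witness. -/
theorem exists_add_smul_of_notMem {M : Submodule S (S × S)} (hM : Maximal ProperRel M)
    {p : S × S} (hp : p ∉ M) : ∃ m ∈ M, ∃ t c : S, m + t • p = (c + 1, c) := by
  by_contra! h
  refine hp (hM.2 (y := M ⊔ Submodule.span S {p}) ?_ le_sup_left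
    (Submodule.mem_sup_right (Submodule.mem_span_singleton_self p)))
  intro c hc
  obtain ⟨m, hm, z, hz, he⟩ := Submodule.mem_sup.1 hc
  obtain ⟨t, rfl⟩ := Submodule.mem_span_singleton.1 hz
  exact h m hm t c he

/-- In a witness `m + t • (x, z) = (c + 1, c)`, replace `(x, z)` by `(x, y) + (y, z)`. The extra `t
* y` appears on both sides and is absorbed into `c`. -/
theorem trans_of_maximal {M : Submodule S (S × S)} (hM : Maximal ProperRel M)
    {x y z : S}
    (hxy : (x, y) ∈ M) (hyz : (y, z) ∈ M) : (x, z) ∈ M := by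
  by_contra h
  obtain ⟨⟨m1, m2⟩, hm, t, c, e⟩ := exists_add_smul_of_notMem hM h
  have := M.add_mem hm (M.smul_mem t (M.add_mem hxy hyz))
  simp only [Prod.smul_mk, smul_eq_mul, Prod.mk_add_mk, Prod.mk.injEq] at e this
  refine hM.1 (c + t * y) ?_
  convert this using 2
  · rw [add_right_comm, ← e.1]; ring
  · nth_rw 1 [← e.2]; ring

end Cone

section Spectrum

variable {S : Type*} [CommSemiring S] [Preorder S] [StrassenPreorder S]

/-- The preorder of `S` as a submodule of `S × S`. -/
def orderRel (S : Type*) [CommSemiring S] [Preorder S] [StrassenPreorder S] :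
    Submodule S (S × S) where
  carrier := {p | p.1 ≤ p.2}
  add_mem' h k := add_le_add h k
  zero_mem' := le_rfl
  smul_mem' c _ h := mul_le_mul_right h c

theorem mem_orderRel {x y : S} : (x, y) ∈ orderRel S ↔ x ≤ y := Iff.rfl

variable {M : Submodule S (S × S)}

/-- Weighting the two failure witnesses by `t'` and `t` makes their `x`, `y` contributions
symmetric, so they become a reflexive pair in `M`. The excess is then `t + t'`; the pairs `(1, t)`
and `(0, t')` reduce it to exactly `1`, which properness forbids. -/
theorem total_of_maximal (hM : Maximal ProperRel M) (hle : orderRel S ≤ M) (x y : S) :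
    (x, y) ∈ M ∨ (y, x) ∈ M := by
  by_contra! h
  obtain ⟨m, hm, t, c, e⟩ := exists_add_smul_of_notMem hM h.1
  obtain ⟨m', hm', t', c', e'⟩ := exists_add_smul_of_notMem hM h.2
  have ht : t ≠ 0 := by
    rintro rfl
    rw [zero_smul, add_zero] at e
    exact hM.1 c (e ▸ hm)
  have h1 : ((1 : S), t) ∈ M := hle (StrassenPreorder.one_le_of_ne_zero t ht)
  have h2 : (0, t') ∈ M := hle (StrassenPreorder.nonneg t')
  have h3 : ((t * t') * (x + y), (t * t') * (x + y)) ∈ M := hle (mem_orderRel.2 le_rfl)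
  have := M.add_mem (M.add_mem (M.add_mem (M.smul_mem t' hm) (M.smul_mem t hm')) h3)
    (M.add_mem h1 h2)
  obtain ⟨m1, m2⟩ := m
  obtain ⟨m1', m2'⟩ := m'
  simp only [Prod.smul_mk, smul_eq_mul, Prod.mk_add_mk, Prod.mk.injEq] at e e' this
  refine hM.1 (t' * c + t * c' + t + t') ?_
  convert this using 2
  · trans t' * (c + 1) + t * (c' + 1) + 1
    · ring
    · rw [← e.1, ← e'.1]; ring
  · trans t' * c + t * c' + t + t'
    · ring
    · nth_rw 1 [← e.2, ← e'.2]; ring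

end Spectrum

/-! ### The real character of a maximal relation -/

section Character

variable {S : Type*} [CommSemiring S] [Preorder S] [StrassenPreorder S]
variable {M : Submodule S (S × S)}

theorem natCast_le_of_mem (hM : Maximal ProperRel M) (hle : orderRel S ≤ M) {m n : ℕ}
    (h : ((m : S), (n : S)) ∈ M) : m ≤ n := by
  by_contra! hlt
  refine hM.1 n (trans_of_maximal hM (hle ?_) h)
  obtain ⟨k, rfl⟩ := Nat.exists_eq_add_of_lt hlt
  rw [mem_orderRel]
  push_cast
  rw [add_right_comm]
  exact le_add_of_nonneg_right (StrassenPreorder.nonneg _)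

/-- The fractions `m / n` for which `m` is below `n * x` in the relation `M`. -/
def lowerFractions (M : Submodule S (S × S)) (x : S) : Set ℝ :=
  {q | ∃ m n : ℕ, 0 < n ∧ ((m : S), n * x) ∈ M ∧ q = m / n}

/-- The real number that a maximal proper relation assigns to an element. -/
noncomputable def character (M : Submodule S (S × S)) (x : S) : ℝ := sSup (lowerFractions M x)

theorem zero_mem_lowerFractions (hle : orderRel S ≤ M) (x : S) : 0 ∈ lowerFractions M x :=
  ⟨0, 1, one_pos, hle (by simpa [mem_orderRel] using StrassenPreorder.nonneg x), by simp⟩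

theorem lowerFractions_le (hM : Maximal ProperRel M) (hle : orderRel S ≤ M) {x : S} {q : ℝ}
    (hq : q ∈ lowerFractions M x) {m n : ℕ} (hn : 0 < n) (h : (n * x, (m : S)) ∈ M) :
    q ≤ m / n := by
  obtain ⟨m', n', hn', h', rfl⟩ := hq
  have h1 := M.smul_mem (n : S) h'
  have h2 := M.smul_mem (n' : S) h
  simp only [Prod.smul_mk, smul_eq_mul] at h1 h2
  rw [mul_left_comm] at h1
  have := natCast_le_of_mem hM hle (m := n * m') (n := n' * m)
    (by push_cast; exact trans_of_maximal hM h1 h2)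
  rw [div_le_div_iff₀ (by positivity) (by positivity)]
  have : (n * m' : ℝ) ≤ n' * m := mod_cast this
  linarith

theorem character_le (hM : Maximal ProperRel M) (hle : orderRel S ≤ M) {x : S}
    {m n : ℕ} (hn : 0 < n) (h : (n * x, (m : S)) ∈ M) : character M x ≤ m / n :=
  csSup_le ⟨0, zero_mem_lowerFractions hle x⟩ fun _ hq => lowerFractions_le hM hle hq hn h

theorem bddAbove_lowerFractions (hM : Maximal ProperRel M) (hle : orderRel S ≤ M) (x : S) :
    BddAbove (lowerFractions M x) := by
  obtain ⟨k, hk⟩ := StrassenPreorder.exists_le_natCast x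
  refine ⟨k / (1 : ℕ), fun q hq => lowerFractions_le hM hle hq one_pos (hle ?_)⟩
  simpa [mem_orderRel] using hk

theorem le_character (hM : Maximal ProperRel M) (hle : orderRel S ≤ M) {x : S}
    {m n : ℕ} (hn : 0 < n) (h : ((m : S), n * x) ∈ M) : (m / n : ℝ) ≤ character M x :=
  le_csSup (bddAbove_lowerFractions hM hle x) ⟨m, n, hn, h, rfl⟩

theorem character_nonneg (hM : Maximal ProperRel M) (hle : orderRel S ≤ M) (x : S) :
    0 ≤ character M x :=
  le_csSup (bddAbove_lowerFractions hM hle x) (zero_mem_lowerFractions hle x)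

theorem character_mono (hM : Maximal ProperRel M) (hle : orderRel S ≤ M) {x y : S}
    (h : (x, y) ∈ M) : character M x ≤ character M y := by
  refine csSup_le ⟨0, zero_mem_lowerFractions hle x⟩ ?_
  rintro _ ⟨m, n, hn, h', rfl⟩
  exact le_character hM hle hn (trans_of_maximal hM h' (M.smul_mem (n : S) h))

theorem character_natCast (hM : Maximal ProperRel M) (hle : orderRel S ≤ M) (k : ℕ) :
    character M (k : S) = k := by
  have h : ((k : S), (1 : ℕ) * (k : S)) ∈ M := hle (by simp [mem_orderRel])
  have h' : ((1 : ℕ) * (k : S), (k : S)) ∈ M := hle (by simp [mem_orderRel])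
  apply le_antisymm
  · simpa using character_le hM hle one_pos h'
  · simpa using le_character hM hle one_pos h

theorem character_mul_le (hle : orderRel S ≤ M) {x : S} {a b : ℝ}
    (ha : 0 ≤ a)
    (h : ∀ m n : ℕ, 0 < n → ((m : S), n * x) ∈ M → (m / n : ℝ) * a ≤ b) :
    character M x * a ≤ b := by
  rcases ha.eq_or_lt with rfl | ha
  · simpa using h 0 1 one_pos (hle (by simpa [mem_orderRel] using StrassenPreorder.nonneg x))
  · rw [← le_div_iff₀ ha]
    refine csSup_le ⟨0, zero_mem_lowerFractions hle x⟩ ?_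
    rintro _ ⟨m, n, hn, h', rfl⟩
    rw [le_div_iff₀ ha]
    exact h m n hn h'

/-- Totality makes the supremum of lower fractions equal to the infimum of upper ones: a rational
above the supremum is not a lower fraction, hence is an upper one. -/
theorem exists_fraction_lt (hM : Maximal ProperRel M) (hle : orderRel S ≤ M) {x : S} {r : ℝ}
    (hr : character M x < r) : ∃ m n : ℕ, 0 < n ∧ (n * x, (m : S)) ∈ M ∧ (m / n : ℝ) < r := by
  obtain ⟨q, hq, hqr⟩ := exists_rat_btwn hr
  have hq0 : 0 < q := by exact_mod_cast (character_nonneg hM hle x).trans_lt hq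
  have hqe : (q : ℝ) = (q.num.toNat : ℝ) / (q.den : ℝ) := by
    conv_lhs => rw [Rat.cast_def]
    congr 1
    exact_mod_cast (Int.toNat_of_nonneg (Rat.num_nonneg.2 hq0.le)).symm
  refine ⟨q.num.toNat, q.den, q.den_pos, ?_, hqe ▸ hqr⟩
  refine (total_of_maximal hM hle _ _).resolve_right fun h => ?_
  exact absurd (le_character hM hle q.den_pos h) (not_le.2 (hqe ▸ hq))

theorem le_character_mul (hM : Maximal ProperRel M) (hle : orderRel S ≤ M) {x : S} {a b : ℝ}
    (ha : 0 ≤ a)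
    (h : ∀ m n : ℕ, 0 < n → (n * x, (m : S)) ∈ M → b ≤ (m / n : ℝ) * a) :
    b ≤ character M x * a := by
  rcases ha.eq_or_lt with rfl | ha
  · obtain ⟨m, n, hn, h', -⟩ := exists_fraction_lt hM hle (lt_add_one (character M x))
    simpa using h m n hn h'
  · by_contra! hlt
    obtain ⟨m, n, hn, h', hq⟩ := exists_fraction_lt hM hle ((lt_div_iff₀ ha).2 hlt)
    exact absurd (h m n hn h') (not_le.2 ((lt_div_iff₀ ha).1 hq))

theorem character_add (hM : Maximal ProperRel M) (hle : orderRel S ≤ M) (x y : S) :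
    character M (x + y) = character M x + character M y := by
  apply le_antisymm
  · have key : ∀ m n m' n' : ℕ, 0 < n → 0 < n' → (n * x, (m : S)) ∈ M → (n' * y, (m' : S)) ∈ M →
        character M (x + y) ≤ m / n + m' / n' := by
      intro m n m' n' hn hn' h h'
      have := character_le hM hle (x := x + y) (m := n' * m + n * m') (n := n * n')
        (Nat.mul_pos hn hn') (by
          convert M.add_mem (M.smul_mem (n' : S) h) (M.smul_mem (n : S) h') using 1
          simp only [Prod.smul_mk, smul_eq_mul, Prod.mk_add_mk, Prod.mk.injEq]
          push_cast
          constructor <;> ring)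
      refine this.trans_eq ?_
      push_cast
      field_simp
    refine le_of_forall_pos_lt_add fun ε hε => ?_
    obtain ⟨m, n, hn, h, hq⟩ := exists_fraction_lt hM hle
      (lt_add_of_pos_right (character M x) (half_pos hε))
    obtain ⟨m', n', hn', h', hq'⟩ := exists_fraction_lt hM hle
      (lt_add_of_pos_right (character M y) (half_pos hε))
    linarith [key m n m' n' hn hn' h h']
  · rw [← le_sub_iff_add_le]
    refine csSup_le ⟨0, zero_mem_lowerFractions hle x⟩ ?_
    rintro _ ⟨m, n, hn, h, rfl⟩
    rw [le_sub_iff_add_le, ← le_sub_iff_add_le']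
    refine csSup_le ⟨0, zero_mem_lowerFractions hle y⟩ ?_
    rintro _ ⟨m', n', hn', h', rfl⟩
    rw [le_sub_iff_add_le']
    have := le_character hM hle (x := x + y) (m := n' * m + n * m') (n := n * n')
      (Nat.mul_pos hn hn') (by
        convert M.add_mem (M.smul_mem (n' : S) h) (M.smul_mem (n : S) h') using 1
        simp only [Prod.smul_mk, smul_eq_mul, Prod.mk_add_mk, Prod.mk.injEq]
        push_cast
        constructor <;> ring)
    refine Eq.trans_le ?_ this
    push_cast
    field_simp

theorem character_natCast_mul (hM : Maximal ProperRel M) (hle : orderRel S ≤ M) (k : ℕ) (x : S) :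
    character M (k * x) = k * character M x := by
  induction k with
  | zero => simpa using character_natCast hM hle 0
  | succ k ih =>
    push_cast
    rw [add_mul, add_mul, character_add hM hle, ih, one_mul, one_mul]

/-- Multiplying a comparison of `n * x` with `m` by `y` and using additivity compares `n * character
M (x * y)` with `m * character M y`; the fractions `m / n` approximate `character M x` from either
side. -/
theorem character_mul (hM : Maximal ProperRel M) (hle : orderRel S ≤ M) (x y : S) :
    character M (x * y) = character M x * character M y := by
  apply le_antisymm
  · refine le_character_mul hM hle (character_nonneg hM hle y) fun m n hn h => ?_
    have := character_mono hM hle (M.smul_mem y h)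
    simp only [smul_eq_mul] at this
    rw [mul_comm y m, mul_comm y, mul_assoc, character_natCast_mul hM hle,
      character_natCast_mul hM hle] at this
    rw [div_mul_eq_mul_div, le_div_iff₀ (by positivity)]
    linarith
  · refine character_mul_le hle (character_nonneg hM hle y) fun m n hn h => ?_
    have := character_mono hM hle (M.smul_mem y h)
    simp only [smul_eq_mul] at this
    rw [mul_comm y m, mul_comm y, mul_assoc, character_natCast_mul hM hle,
      character_natCast_mul hM hle] at this
    rw [div_mul_eq_mul_div, div_le_iff₀ (by positivity)]
    linarith

/-- The monotone semiring homomorphism to the nonnegative reals given by a maximal proper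
relation. -/
noncomputable def characterHom (hM : Maximal ProperRel M) (hle : orderRel S ≤ M) : S →+*o ℝ≥0 where
  toFun x := ⟨character M x, character_nonneg hM hle x⟩
  map_zero' := NNReal.eq (show character M 0 = 0 by simpa using character_natCast hM hle 0)
  map_one' := NNReal.eq (show character M 1 = 1 by simpa using character_natCast hM hle 1)
  map_add' x y := NNReal.eq (character_add hM hle x y)
  map_mul' x y := NNReal.eq (character_mul hM hle x y)
  monotone' _ _ h := character_mono hM hle (hle h)

/-! ### Strassen duality and amplification -/

/-- If every monotone homomorphism to the nonnegative reals is strictly larger at `b` than at `a`,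
then `a + 1 ≤ b` holds after scaling and adding a common summand. -/
theorem exists_mul_add_le {a b : S} (h : ∀ φ : S →+*o ℝ≥0, φ a < φ b) :
    ∃ s d : S, s * a + 1 + d ≤ s * b + d := by
  by_contra! hn
  have hprop : ProperRel (orderRel S ⊔ Submodule.span S {(b, a)}) := by
    intro c hc
    obtain ⟨⟨x, y⟩, hm, z, hz, he⟩ := Submodule.mem_sup.1 hc
    obtain ⟨s, rfl⟩ := Submodule.mem_span_singleton.1 hz
    simp only [Prod.smul_mk, smul_eq_mul, Prod.mk_add_mk, Prod.mk.injEq] at he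
    -- Here `x ≤ y`, `x + s * b = c + 1` and `y + s * a = c`; adding `s * b + y + s * a` to `x ≤ y`
    -- gives the excluded inequality.
    refine hn s (c + y) ?_
    calc s * a + 1 + (c + y) = x + (s * b + (y + s * a)) := by rw [← add_assoc x, he.1]; ring
      _ ≤ y + (s * b + (y + s * a)) := add_le_add_left (mem_orderRel.1 hm) _
      _ = s * b + (c + y) := by rw [he.2]; ring
  obtain ⟨M, hle, hM⟩ := hprop.exists_maximal
  have hle' := le_sup_left.trans hle
  refine absurd (h (characterHom hM hle')) (not_lt.2 ?_)
  exact character_mono hM hle'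
    (hle (Submodule.mem_sup_right (Submodule.mem_span_singleton_self _)))

theorem natCast_mul_add_le {x y d : S} (h : x + d ≤ y + d) (n : ℕ) :
    n * x + d ≤ n * y + d := by
  induction n with
  | zero => simp
  | succ n ih =>
    calc ((n + 1 : ℕ) : S) * x + d = n * x + d + x := by push_cast; ring
      _ ≤ n * y + d + x := add_le_add_left ih x
      _ = n * y + (x + d) := by ring
      _ ≤ n * y + (y + d) := add_le_add_right h _
      _ = ((n + 1 : ℕ) : S) * y + d := by push_cast; ring

theorem mul_pow_le_mul_pow {c x y : S} (h : c * x ≤ c * y) (n : ℕ) : c * x ^ n ≤ c * y ^ n := by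
  induction n with
  | zero => simp
  | succ n ih =>
    calc c * x ^ (n + 1) = x * (c * x ^ n) := by ring
      _ ≤ x * (c * y ^ n) := mul_le_mul_right ih x
      _ = y ^ n * (c * x) := by ring
      _ ≤ y ^ n * (c * y) := mul_le_mul_right h _
      _ = c * y ^ (n + 1) := by ring

/-- Only one factor `s` is carried along: each step spends it on one replacement and recovers it. -/
theorem natCast_pow_mul_pow_le {s x y : S} {m n : ℕ} (h : m * (s * x) ≤ n * (s * y)) (j : ℕ) :
    (m ^ j : ℕ) * (s * x ^ j) ≤ (n ^ j : ℕ) * (s * y ^ j) := by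
  induction j with
  | zero => simp
  | succ j ih =>
    push_cast at ih ⊢
    calc (m : S) ^ (j + 1) * (s * x ^ (j + 1)) = (m * x) * (m ^ j * (s * x ^ j)) := by ring
      _ ≤ (m * x) * (n ^ j * (s * y ^ j)) := mul_le_mul_right ih _
      _ = (n ^ j * y ^ j) * (m * (s * x)) := by ring
      _ ≤ (n ^ j * y ^ j) * (n * (s * y)) := mul_le_mul_right h _
      _ = (n : S) ^ (j + 1) * (s * y ^ (j + 1)) := by ring

theorem exists_add_pow_le_two_mul_pow (k j : ℕ) : ∃ n : ℕ, 0 < n ∧ (n + k) ^ j ≤ 2 * n ^ j := by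
  have h : Filter.Tendsto (fun n : ℕ => (1 + k / (n : ℝ)) ^ j) Filter.atTop (nhds ((1 + 0) ^ j)) :=
    (tendsto_const_nhds.add (tendsto_const_div_atTop_nhds_zero_nat (k : ℝ))).pow j
  obtain ⟨n, h1, hn⟩ := ((h.eventually_lt_const (u := 2) (by norm_num)).and
    (Filter.eventually_gt_atTop 0)).exists
  refine ⟨n, hn, ?_⟩
  have hn' : (0 : ℝ) < n := by exact_mod_cast hn
  have e : (1 + k / (n : ℝ)) = (n + k) / n := by field_simp
  rw [e, div_pow, div_lt_iff₀ (by positivity)] at h1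
  exact_mod_cast h1.le

/-- Strassen's theorem: if `a` is strictly smaller than `b` in the spectrum, then large powers of
`a` are bounded by the corresponding powers of `b` up to a subexponential factor. -/
theorem exists_pow_le {a b : S} (hb : b ≠ 0) (h : ∀ φ : S →+*o ℝ≥0, φ a < φ b) (j : ℕ) :
    ∃ l : ℕ, ∀ i : ℕ, a ^ (j * i) ≤ l * (2 * b ^ j) ^ i := by
  obtain ⟨s, d, hsd⟩ := exists_mul_add_le h
  obtain ⟨k, hk⟩ := StrassenPreorder.exists_le_natCast d
  -- For `s = 0` the inequality is `1 + d ≤ d`; iterating it `k + 1` times forces `k + 1 ≤ k`.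
  have hs : s ≠ 0 := by
    rintro rfl
    have h1 : (0 + 1 : S) + d ≤ 0 + d := by simpa using hsd
    have h2 := natCast_mul_add_le h1 (k + 1)
    have h3 : ((k + 1 : ℕ) : S) ≤ k := by
      calc ((k + 1 : ℕ) : S) ≤ (k + 1 : ℕ) * (0 + 1) + d := by
            simpa using le_add_of_nonneg_right (StrassenPreorder.nonneg d)
        _ ≤ (k + 1 : ℕ) * 0 + d := h2
        _ ≤ k := by simpa using hk
    have := StrassenPreorder.natCast_reflect (S := S) _ _ h3
    omega
  have hs1 := StrassenPreorder.one_le_of_ne_zero s hs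
  have hb1 := StrassenPreorder.one_le_of_ne_zero b hb
  have hsb : d ≤ k * (s * b) := hk.trans (by
    simpa using mul_le_mul_right (mul_le_mul' hs1 hb1) (k : S))
  have hlin : s * a + d ≤ s * b + d :=
    le_trans (add_le_add_left (le_add_of_nonneg_right (StrassenPreorder.nonneg 1)) d) hsd
  -- Absorbing `d` costs a factor `(n + k) / n`; `n` is large enough that its `j`-th power is at
  -- most `2`.
  obtain ⟨n, hn, hnk⟩ := exists_add_pow_le_two_mul_pow k j
  have h1 : (n : S) * (s * a) ≤ (n + k : ℕ) * (s * b) := by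
    calc (n : S) * (s * a) ≤ n * (s * a) + d := le_add_of_nonneg_right (StrassenPreorder.nonneg d)
      _ ≤ n * (s * b) + d := natCast_mul_add_le hlin n
      _ ≤ n * (s * b) + k * (s * b) := add_le_add_right hsb _
      _ = (n + k : ℕ) * (s * b) := by push_cast; ring
  have cast_mono : ∀ {p q : ℕ}, p ≤ q → (p : S) ≤ q := by
    intro p q hpq
    obtain ⟨r, rfl⟩ := Nat.exists_eq_add_of_le hpq
    push_cast
    exact le_add_of_nonneg_right (StrassenPreorder.nonneg _)
  have h2 : ((n ^ j : ℕ) * s : S) * a ^ j ≤ ((n ^ j : ℕ) * s : S) * (2 * b ^ j) := by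
    calc ((n ^ j : ℕ) * s : S) * a ^ j = (n ^ j : ℕ) * (s * a ^ j) := by ring
      _ ≤ ((n + k) ^ j : ℕ) * (s * b ^ j) := natCast_pow_mul_pow_le h1 j
      _ ≤ (2 * n ^ j : ℕ) * (s * b ^ j) := mul_le_mul_left (cast_mono hnk) _
      _ = ((n ^ j : ℕ) * s : S) * (2 * b ^ j) := by push_cast; ring
  obtain ⟨l, hl⟩ := StrassenPreorder.exists_le_natCast ((n ^ j : ℕ) * s : S)
  -- The catalyst `n ^ j * s` lies between `1` and `l` whatever `i` is, so it costs only a constant.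
  refine ⟨l, fun i => ?_⟩
  have hc : (1 : S) ≤ (n ^ j : ℕ) * s := by
    have : ((1 : ℕ) : S) ≤ (n ^ j : ℕ) := cast_mono (Nat.one_le_pow _ _ hn)
    simpa using mul_le_mul' this hs1
  calc a ^ (j * i) = 1 * (a ^ j) ^ i := by rw [pow_mul, one_mul]
    _ ≤ ((n ^ j : ℕ) * s : S) * (a ^ j) ^ i := mul_le_mul_left hc _
    _ ≤ ((n ^ j : ℕ) * s : S) * (2 * b ^ j) ^ i := mul_pow_le_mul_pow h2 i
    _ ≤ l * (2 * b ^ j) ^ i := mul_le_mul_left hl _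

end Character

/-! ### Finite graphs form a Strassen preorder -/

theorem join_hom {V W W' : Type*} {G : SimpleGraph V} {H : SimpleGraph W} {H' : SimpleGraph W'}
    (h : HomExists H H') : HomExists (join G H) (join G H') := by
  obtain ⟨f⟩ := h
  refine ⟨⟨Sum.map id f, ?_⟩⟩
  rintro (v | w) (v' | w') h
  · exact h
  · trivial
  · trivial
  · exact f.map_adj h

theorem disjProd_hom {V W W' : Type*} {G : SimpleGraph V} {H : SimpleGraph W}
    {H' : SimpleGraph W'} (h : HomExists H H') : HomExists (disjProd G H) (disjProd G H') := by
  obtain ⟨f⟩ := h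
  exact ⟨⟨Prod.map id f, fun h => h.imp id f.map_adj⟩⟩

theorem FinGraph.natCast_eq (n : ℕ) :
    (n : FinGraph.{u}) = FinGraph.mk (⊤ : SimpleGraph (ULift.{u} (Fin n))) := by
  induction n with
  | zero =>
    rw [Nat.cast_zero, FinGraph.zero_def]
    exact FinGraph.mk_eq (Equiv.equivOfIsEmpty _ _) fun v => v.elim
  | succ n ih =>
    rw [Nat.cast_succ, ih, FinGraph.one_def, FinGraph.mk_add_mk]
    refine FinGraph.mk_eq
      ((Equiv.sumCongr Equiv.ulift (Equiv.ofUnique _ _)).trans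
        (finSumFinEquiv.trans Equiv.ulift.symm)) fun v v' => ?_
    rw [SimpleGraph.top_adj, ne_eq, EmbeddingLike.apply_eq_iff_eq]
    rcases v with v | v <;> rcases v' with v' | v' <;> simp [join]

theorem FinGraph.mk_pow {V : Type u} [Finite V] (G : SimpleGraph V) (n : ℕ) :
    FinGraph.mk G ^ n = FinGraph.mk (disjPow G n) := by
  induction n with
  | zero =>
    rw [pow_zero, FinGraph.one_def]
    refine FinGraph.mk_eq (Equiv.ofUnique _ _) fun v v' => ?_
    simp [disjPow]
  | succ n ih =>
    rw [pow_succ', ih, FinGraph.mk_mul_mk]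
    refine FinGraph.mk_eq (Fin.consEquiv fun _ => V) fun v v' => ?_
    simp [disjPow, disjProd, Fin.exists_fin_succ]

theorem FinGraph.mk_ne_zero {V : Type u} [Finite V] [Nonempty V] (G : SimpleGraph V) :
    FinGraph.mk G ≠ 0 := by
  intro h
  obtain ⟨f⟩ := (FinGraph.mk_le_mk _ _).1 (h.le.trans_eq FinGraph.zero_def)
  exact (f (Classical.arbitrary V)).elim

theorem FinGraph.two_le_mk {V : Type u} [Finite V] {G : SimpleGraph V}
    (hG : G.edgeSet.Nonempty) : 2 ≤ FinGraph.mk G := by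
  obtain ⟨e, he⟩ := hG
  induction e using Sym2.ind with
  | h a b =>
  have hab : G.Adj a b := he
  have h2 : (2 : FinGraph.{u}) = (2 : ℕ) := by norm_num
  rw [h2, FinGraph.natCast_eq, FinGraph.mk_le_mk]
  refine ⟨⟨fun i => if i.down = 0 then a else b, ?_⟩⟩
  rintro ⟨i⟩ ⟨j⟩ hij
  fin_cases i <;> fin_cases j <;> simp_all [hab.symm]

instance : StrassenPreorder FinGraph.{u} where
  add_le_add_left x y h z := by
    rw [add_comm x, add_comm y]
    induction x using FinGraph.ind with
    | h V G =>
    induction y using FinGraph.ind with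
    | h W H =>
    induction z using FinGraph.ind with
    | h X K => exact join_hom h
  elim z x y h := by
    induction x using FinGraph.ind with
    | h V G =>
    induction y using FinGraph.ind with
    | h W H =>
    induction z using FinGraph.ind with
    | h X K => exact disjProd_hom h
  nonneg x := by
    induction x using FinGraph.ind with
    | h V G => exact ⟨⟨PEmpty.elim, fun {v} => v.elim⟩⟩
  one_le_of_ne_zero x hx := by
    induction x using FinGraph.ind with
    | h V G =>
    rcases isEmpty_or_nonempty V with hV | ⟨⟨v⟩⟩
    · exact absurd (FinGraph.mk_eq (Equiv.equivOfIsEmpty _ _) fun v => hV.elim v) hx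
    · exact ⟨⟨fun _ => v, fun h => h.elim⟩⟩
  exists_le_natCast x := by
    induction x using FinGraph.ind with
    | h V G =>
    refine ⟨Nat.card V, ?_⟩
    rw [FinGraph.natCast_eq]
    exact ⟨⟨fun v => ⟨Finite.equivFin V v⟩, fun h => by simpa using h.ne⟩⟩
  natCast_reflect m n h := by
    rw [FinGraph.natCast_eq, FinGraph.natCast_eq, FinGraph.mk_le_mk] at h
    obtain ⟨f⟩ := h
    have hf : Function.Injective f := fun v w hvw => by
      by_contra hne
      exact (f.map_adj (SimpleGraph.top_adj _ _ |>.2 hne)).ne hvw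
    simpa using Nat.card_le_card_of_injective f hf

/-! ### The rate formula -/

open Filter Topology

theorem one_le_invariant (η : SemiringHomomorphicInvariant.{u}) {x : FinGraph.{u}} (hx : x ≠ 0) :
    (1 : ℝ) ≤ η x := by
  have := η.monotone' (StrassenPreorder.one_le_of_ne_zero x hx)
  have h1 : (1 : ℝ≥0) ≤ η x := by simpa using this
  exact_mod_cast h1

theorem one_lt_invariant (η : SemiringHomomorphicInvariant.{u}) {x : FinGraph.{u}} (hx : 2 ≤ x) :
    (1 : ℝ) < η x := by
  have : η 2 ≤ η x := η.monotone' hx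
  rw [map_ofNat] at this
  have h1 : (2 : ℝ≥0) ≤ η x := this
  have h2 : (2 : ℝ) ≤ η x := by exact_mod_cast h1
  linarith

theorem natCast_div_eq_ofReal (m : ℕ) {n : ℕ} (hn : 0 < n) :
    (m : ℝ≥0∞) / n = ENNReal.ofReal (m / n : ℝ) := by
  rw [ENNReal.ofReal_div_of_pos (by positivity), ENNReal.ofReal_natCast, ENNReal.ofReal_natCast]

variable {V W : Type u} [Finite V] [Finite W] {G : SimpleGraph V} {H : SimpleGraph W}

theorem homExists_disjPow_iff (m n : ℕ) :
    HomExists (disjPow H m) (disjPow G n) ↔ FinGraph.mk H ^ m ≤ FinGraph.mk G ^ n := by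
  rw [FinGraph.mk_pow, FinGraph.mk_pow, FinGraph.mk_le_mk]

theorem natCast_div_mul_logInv (η : SemiringHomomorphicInvariant.{u}) (m : ℕ) {n : ℕ}
    (hn : 0 < n) :
    (m : ℝ≥0∞) / n * logInv η H =
      ENNReal.ofReal (m / n * Real.log (η (FinGraph.mk H))) := by
  rw [natCast_div_eq_ofReal m hn, logInv, ← ENNReal.ofReal_mul (by positivity)]

theorem logInv_ne_zero (hG : G.edgeSet.Nonempty) (η : SemiringHomomorphicInvariant.{u}) :
    logInv η G ≠ 0 := by
  rw [logInv, ne_eq, ENNReal.ofReal_eq_zero, not_le]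
  exact Real.log_pos (one_lt_invariant η (FinGraph.two_le_mk hG))

theorem logInv_ne_top (η : SemiringHomomorphicInvariant.{u}) : logInv η G ≠ ∞ :=
  ENNReal.ofReal_ne_top

theorem rate_le_logInv_div (hG : G.edgeSet.Nonempty) (hH : Nonempty W)
    (η : SemiringHomomorphicInvariant.{u}) : rate G H ≤ logInv η G / logInv η H := by
  refine sSup_le ?_
  rintro _ ⟨m, n, hn, h, rfl⟩
  have hpos := one_le_invariant η (FinGraph.mk_ne_zero H)
  -- An edge of `G` makes the numerator nonzero, so the quotient is `∞` when `logInv η H = 0`.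
  rw [ENNReal.le_div_iff_mul_le (Or.inr (logInv_ne_zero hG η)) (Or.inl (logInv_ne_top η)),
    natCast_div_mul_logInv η m hn, logInv]
  refine ENNReal.ofReal_le_ofReal ?_
  have h1 : η (FinGraph.mk H ^ m) ≤ η (FinGraph.mk G ^ n) :=
    η.monotone' ((homExists_disjPow_iff m n).1 h)
  rw [map_pow, map_pow] at h1
  have h2 : (η (FinGraph.mk H) : ℝ) ^ m ≤ (η (FinGraph.mk G) : ℝ) ^ n := by exact_mod_cast h1
  have h3 := Real.log_le_log (by positivity) h2
  rw [Real.log_pow, Real.log_pow] at h3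
  rw [div_mul_eq_mul_div, div_le_iff₀ (by positivity)]
  linarith

theorem invariant_pow_lt (hG : G.edgeSet.Nonempty) (hH : Nonempty W) {p q : ℕ} (hq : 0 < q)
    (η : SemiringHomomorphicInvariant.{u}) (h : (p : ℝ≥0∞) / q < logInv η G / logInv η H) :
    η (FinGraph.mk H ^ p) < η (FinGraph.mk G ^ q) := by
  have hG1 := one_lt_invariant η (FinGraph.two_le_mk hG)
  have hH1 := one_le_invariant η (FinGraph.mk_ne_zero H)
  have hfin : (p : ℝ≥0∞) / q ≠ ∞ := natCast_div_eq_ofReal p hq ▸ ENNReal.ofReal_ne_top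
  rw [ENNReal.lt_div_iff_mul_lt (Or.inr hfin) (Or.inl (logInv_ne_top η)),
    natCast_div_mul_logInv η p hq, logInv,
    ENNReal.ofReal_lt_ofReal_iff (Real.log_pos hG1),
    div_mul_eq_mul_div, div_lt_iff₀ (by positivity), mul_comm _ (q : ℝ),
    ← Real.log_pow, ← Real.log_pow, Real.log_lt_log_iff (by positivity) (by positivity)] at h
  rw [map_pow, map_pow]
  exact_mod_cast h

theorem FinGraph.natCast_le_pow {x : FinGraph.{u}} (hx : 2 ≤ x) (l : ℕ) :
    (l : FinGraph.{u}) ≤ x ^ l := by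
  calc (l : FinGraph.{u}) ≤ (2 : FinGraph.{u}) ^ l := by
        obtain ⟨r, hr⟩ := Nat.exists_eq_add_of_le (Nat.lt_two_pow_self (n := l)).le
        have : (2 : FinGraph.{u}) ^ l = l + r := by exact_mod_cast congrArg (Nat.cast) hr
        rw [this]
        exact le_add_of_nonneg_right (StrassenPreorder.nonneg _)
    _ ≤ x ^ l := pow_le_pow_left' hx l

theorem le_rate_of_lt_iInf (hG : G.edgeSet.Nonempty) (hH : Nonempty W) {p q : ℕ} (hq : 0 < q)
    (h : (p : ℝ≥0∞) / q < ⨅ η : SemiringHomomorphicInvariant.{u}, logInv η G / logInv η H) :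
    (p : ℝ≥0∞) / q ≤ rate G H := by
  have h2G := FinGraph.two_le_mk hG
  have hpow (j : ℕ) : ∃ l : ℕ, ∀ i : ℕ,
      FinGraph.mk H ^ (p * j * i) ≤ FinGraph.mk G ^ (l + (1 + q * j) * i) := by
    have hV : Nonempty V := hG.elim fun e _ => ⟨e.out.1⟩
    have hGq : FinGraph.mk G ^ q ≠ 0 := by
      rw [FinGraph.mk_pow]
      exact FinGraph.mk_ne_zero _
    obtain ⟨l, hl⟩ := exists_pow_le hGq (fun φ =>
      invariant_pow_lt hG hH hq φ (h.trans_le (iInf_le _ φ))) j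
    refine ⟨l, fun i => ?_⟩
    calc FinGraph.mk H ^ (p * j * i) = (FinGraph.mk H ^ p) ^ (j * i) := by
          rw [← pow_mul, mul_assoc]
      _ ≤ l * (2 * (FinGraph.mk G ^ q) ^ j) ^ i := hl i
      _ ≤ FinGraph.mk G ^ l * (FinGraph.mk G * (FinGraph.mk G ^ q) ^ j) ^ i :=
          mul_le_mul' (FinGraph.natCast_le_pow h2G l)
            (pow_le_pow_left' (mul_le_mul_left h2G _) i)
      _ = FinGraph.mk G ^ (l + (1 + q * j) * i) := by
          rw [pow_add, pow_mul, pow_add, pow_one, pow_mul]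
  have hlim (b : ℝ) (c : ℝ) {d : ℝ} (hd : d ≠ 0) :
      Tendsto (fun k : ℕ => ENNReal.ofReal ((0 + c * k) / (b + d * k))) atTop
        (𝓝 (ENNReal.ofReal (c / d))) :=
    (ENNReal.continuous_ofReal.tendsto _).comp
      (tendsto_add_mul_div_add_mul_atTop_nhds 0 b c hd)
  rw [natCast_div_eq_ofReal p hq]
  -- The constant `l` depends on `j`, so `i → ∞` is taken first, giving `p * j / (1 + q * j)`, and
  -- then `j → ∞`.
  refine le_of_tendsto (hlim 1 p (d := q) (by positivity)) (Eventually.of_forall fun j => ?_)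
  obtain ⟨l, hl⟩ := hpow j
  have hd : (1 + q * j : ℝ) ≠ 0 := by positivity
  rw [zero_add]
  refine le_of_tendsto (hlim l (p * j) hd) ((eventually_gt_atTop 0).mono fun i hi => ?_)
  have hpos : 0 < l + (1 + q * j) * i := by positivity
  refine le_sSup ⟨p * j * i, l + (1 + q * j) * i, hpos, (homExists_disjPow_iff _ _).2 (hl i), ?_⟩
  rw [natCast_div_eq_ofReal _ hpos]
  push_cast
  rw [zero_add]

end GraphRate

theorem mainTheorem7 {V W : Type u} [Finite V] [Finite W] (G : SimpleGraph V) (H : SimpleGraph W)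
    (hG : G.edgeSet.Nonempty) (hH : Nonempty W) :
    GraphRate.rate G H =
      ⨅ η : GraphRate.SemiringHomomorphicInvariant.{u},
        GraphRate.logInv η G / GraphRate.logInv η H := by
  refine le_antisymm (le_iInf fun η => GraphRate.rate_le_logInv_div hG hH η)
    (le_of_forall_lt fun c hc => ?_)
  obtain ⟨r, hr0, hcr, hr⟩ := ENNReal.lt_iff_exists_rat_btwn.1 hc
  have hre : ((Real.toNNReal r : ℝ≥0) : ℝ≥0∞) = (r.num.toNat : ℝ≥0∞) / (r.den : ℝ≥0∞) := by
    rw [GraphRate.natCast_div_eq_ofReal _ r.den_pos, ENNReal.ofReal]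
    congr 2
    conv_lhs => rw [Rat.cast_def]
    congr 1
    exact_mod_cast (Int.toNat_of_nonneg (Rat.num_nonneg.2 hr0)).symm
  rw [hre] at hcr hr
  exact hcr.trans_le (GraphRate.le_rate_of_lt_iInf hG hH r.den_pos hr)
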